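/- **Corollary 4.3.** Let $\lambda>1$, $\theta>0$, $\sigma\neq0$, $\lambda_j=\lambda^j$ for $j\ge1$ and $\lambda_0\ge0$ (for instance $\lambda_0=0$ or $\lambda_0=1$), and put $$\mu_j=\sigma^2\lambda_{j-1}^{2\theta},\qquad \nu_j=\sigma^2\lambda_j^{2\theta}.$$ Let $p=(p_j)_{j\ge1}$ and $m=(m_j)_{j\ge1}$ be in $\ell^2$, not both zero. Consider the forward equation $$\frac{d}{dt}e_j(t)=-(\nu_j+\mu_j)e_j(t)+\nu_{j-1}e_{j-1}(t)+\mu_{j+1}e_{j+1}(t),\qquad e_j(0)=\frac{p_j^2+m_j^2}{\|p\|_2^2+\|m\|_2^2}\qquad(j\ge1,\ t\ge0),$$ with $e_0\equiv0$. A solution is a family of differentiable functions $e_j$ on $[0,\infty)$ satisfying these equations, with $e_j(t)\ge0$, $\sum_{j}e_j(t)<\infty$ for all $t\ge0$, and $\sup_{0\le t\le T}\sum_j e_j(t)<\infty$ for every $T>0$. Let $\eta$ be the minimal process on $\{1,2,\dots\}$ with $\mathbb P(\eta_0=j)=e_j(0)$: it waits in a state $j$ for an exponential time of rate $\nu_j+\mu_j$,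 then moves to $j+1$ with probability $\nu_j/(\nu_j+\mu_j)$ and to $j-1$ with probability $\mu_j/(\nu_j+\mu_j)$; it is killed when it leaves $1$ downwards, and it is defined up to the time $\tau\in(0,\infty]$ at which infinitely many jumps have occurred. Then the forward equation has exactly one solution, namely $e_j(t)=\mathbb P(\eta_t=j)$, the probability that $\eta$ is in the state $j$ at time $t$ after finitely many jumps; in particular $\sum_j e_j(t)\le1$ for all $t\ge 0$. This holds although the minimal process is dishonest, that is, $\mathbb P(\tau<\infty)>0$. -/

import Mathlib

/-- The frequencies `λ_j`: `λ_j = lam ^ j` for `j ≥ 1`, and `λ_0 = lam0`. The value `λ_0` enters only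
the death rate of the state `1`; it is a free parameter `≥ 0`, so that both usual conventions
`λ_0 = 0` (the q-matrix is conservative) and `λ_0 = 1 = lam ^ 0` are covered. -/
noncomputable def shellFreq (lam lam0 : ℝ) (j : ℕ) : ℝ :=
  if j = 0 then lam0 else lam ^ j

/-- The birth rate `ν_j = σ² λ_j ^ (2θ)`. -/
noncomputable def birthRate (lam lam0 σ θ : ℝ) (j : ℕ) : ℝ :=
  σ ^ 2 * shellFreq lam lam0 j ^ (2 * θ)

/-- The death rate `μ_j = σ² λ_{j-1} ^ (2θ)`, used for `j ≥ 1` only. -/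
noncomputable def deathRate (lam lam0 σ θ : ℝ) (j : ℕ) : ℝ :=
  σ ^ 2 * shellFreq lam lam0 (j - 1) ^ (2 * θ)

/-- The normalized initial energies `(p_j² + m_j²) / (‖p‖² + ‖m‖²)` for `j ≥ 1`, and `0` for
`j = 0`; the norms are those of `ℓ²`. -/
noncomputable def initialEnergy (p m : lp (fun _ : ℕ+ => ℝ) 2) (j : ℕ) : ℝ :=
  if h : 0 < j then (p ⟨j, h⟩ ^ 2 + m ⟨j, h⟩ ^ 2) / (‖p‖ ^ 2 + ‖m‖ ^ 2) else 0

/-- `e t j = e_j(t)`, for `t ≥ 0`, is a solution of the forward equation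
`e_j' = -(ν_j + μ_j) e_j + ν_{j-1} e_{j-1} + μ_{j+1} e_{j+1}`, `j ≥ 1`, with `e_0 = 0` and
`e_j(0) = x_j`, in the positive cone of `ℓ¹`, with mass bounded on bounded time intervals.
(The time derivative at `t = 0` is one-sided.) -/
structure IsForwardSolution (μ ν x : ℕ → ℝ) (e : ℝ → ℕ → ℝ) : Prop where
  boundary : ∀ t, 0 ≤ t → e t 0 = 0
  initial : ∀ j, 1 ≤ j → e 0 j = x j
  forward : ∀ j, 1 ≤ j → ∀ t, 0 ≤ t →
    HasDerivWithinAt (fun s => e s j)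
      (-(ν j + μ j) * e t j + ν (j - 1) * e t (j - 1) + μ (j + 1) * e t (j + 1))
      (Set.Ici 0) t
  nonneg : ∀ t, 0 ≤ t → ∀ j, 0 ≤ e t j
  summable : ∀ t, 0 ≤ t → Summable (e t)
  bounded : ∀ T, 0 ≤ T → ∃ C : ℝ, ∀ t, 0 ≤ t → t ≤ T → ∑' j, e t j ≤ C

/-- The probability that the birth and death chain on `{1, 2, …}` started from the distribution `x`
has made exactly `n` jumps by time `t` and is at `j` at time `t`. The chain waits at `j` for an
exponential time of rate `ν_j + μ_j`, then goes to `j + 1` with probability `ν_j / (ν_j + μ_j)` and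
to `j - 1` with probability `μ_j / (ν_j + μ_j)`. If it leaves `1` downwards (possible only when
`μ_1 > 0`), it is killed. In the recursive clause, `s` is the time of the last jump. -/
noncomputable def jumpLaw (μ ν x : ℕ → ℝ) : ℕ → ℝ → ℕ → ℝ
  | 0, t, j => if j = 0 then 0 else x j * Real.exp (-(ν j + μ j) * t)
  | n + 1, t, j => if j = 0 then 0 else
      ∫ s in (0 : ℝ)..t,
        (ν (j - 1) * jumpLaw μ ν x n s (j - 1) + μ (j + 1) * jumpLaw μ ν x n s (j + 1))
          * Real.exp (-(ν j + μ j) * (t - s))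

/-- The law of the minimal process at time `t`: the probability to be at `j` at time `t` after
finitely many jumps. -/
noncomputable def minimalLaw (μ ν x : ℕ → ℝ) (t : ℝ) (j : ℕ) : ℝ :=
  ∑' n, jumpLaw μ ν x n t j

/-- The probability that the minimal process, started from the probability distribution `x`, has
made infinitely many jumps by time `t`: it is then neither in any of the states `1, 2, …` nor has it
been killed, which happens from the state `1` at rate `μ_1`. If `μ_1 = 0`, it is
`1 - ∑ j, e_j(t)`. -/
noncomputable def explosionProb (μ ν x : ℕ → ℝ) (t : ℝ) : ℝ :=
  1 - ∑' j, minimalLaw μ ν x t j - μ 1 * ∫ s in (0 : ℝ)..t, minimalLaw μ ν x s 1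

/-! Existence. The laws after exactly `n` jumps solve a triangular system, so every partial sum over
`n` is explicit. Mass balance bounds these sums by the initial mass, and they increase to the
minimal law. Passing to the limit in the integrated equation gives `isForwardSolution_minimalLaw`.

Uniqueness. Every solution dominates the minimal law (`IsForwardSolution.partialLaw_le`), so the
difference `d` is again a nonnegative solution, now with zero initial value. The rates are
symmetric, `μ_{j+1} = ν_j`. With `D_j = ∫₀ᵗ d_j`, the integrated equation for `j ≥ 2` therefore
reads `d_j(t) = ν_j (D_{j+1} - D_j) - ν_{j-1} (D_j - D_{j-1})`. Hence the fluxes `ν_j (D_{j+1} -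
D_j)` increase with `j`, and the first one is nonnegative. So `D` is nondecreasing, but it is also
summable by the mass bound. It vanishes, and `d` with it (`IsForwardSolution.eq_zero`). The growth
of the rates plays no role here, so explosion is no obstacle.

Dishonesty. For geometric rates there is a function `w ≤ b < 1` with generator at most `-ε`, and at
most `-ε - μ_1` at the state `1`. Dynkin's formula, in the form of a mass balance per jump number,
bounds the killing probability plus `ε` times the expected lifetime by `b`. Without explosion, mass
at least `1 - b` would survive forever, and the expected lifetime would be infinite. -/

open Filter Topology MeasureTheory Finset

/-! ### Laws after a fixed number of jumps -/

section JumpLaw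

variable {μ ν x : ℕ → ℝ}

@[simp]
theorem jumpLaw_state_zero (n : ℕ) (t : ℝ) : jumpLaw μ ν x n t 0 = 0 := by
  cases n <;> simp [jumpLaw]

theorem jumpLaw_zero_apply {j : ℕ} (hj : 1 ≤ j) (t : ℝ) :
    jumpLaw μ ν x 0 t j = x j * Real.exp (-(ν j + μ j) * t) := by
  simp [jumpLaw, Nat.ne_of_gt hj]

theorem jumpLaw_succ_time_zero (n j : ℕ) : jumpLaw μ ν x (n + 1) 0 j = 0 := by
  simp [jumpLaw]

theorem hasDerivAt_jumpLaw_zero {j : ℕ} (hj : 1 ≤ j) (t : ℝ) :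
    HasDerivAt (fun s => jumpLaw μ ν x 0 s j) (-(ν j + μ j) * jumpLaw μ ν x 0 t j) t := by
  simp only [jumpLaw_zero_apply hj]
  refine ((((hasDerivAt_id' t).const_mul (-(ν j + μ j))).exp).const_mul (x j)).congr_deriv ?_
  ring

/-- Pulling the factor `exp (-q t)` out of the integral removes `t` from the integrand, so the
product rule and the fundamental theorem of calculus apply. Continuity at level `n` is a hypothesis
so that `continuous_jumpLaw` can use the result in its induction. -/
theorem hasDerivAt_jumpLaw_succ_of_continuous {n : ℕ}
    (hc : ∀ i, Continuous fun s => jumpLaw μ ν x n s i) {j : ℕ} (hj : 1 ≤ j) (t : ℝ) :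
    HasDerivAt (fun s => jumpLaw μ ν x (n + 1) s j)
      (-(ν j + μ j) * jumpLaw μ ν x (n + 1) t j
        + (ν (j - 1) * jumpLaw μ ν x n t (j - 1) + μ (j + 1) * jumpLaw μ ν x n t (j + 1))) t := by
  set q := ν j + μ j with hq
  set g : ℝ → ℝ := fun s =>
    ν (j - 1) * jumpLaw μ ν x n s (j - 1) + μ (j + 1) * jumpLaw μ ν x n s (j + 1) with hg
  have hgc : Continuous g :=
    ((hc _).const_mul _).add ((hc _).const_mul _)
  have key : ∀ s, jumpLaw μ ν x (n + 1) s j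
      = Real.exp (-q * s) * ∫ r in (0 : ℝ)..s, g r * Real.exp (q * r) := by
    intro s
    rw [← intervalIntegral.integral_const_mul]
    simp only [jumpLaw, Nat.ne_of_gt hj, if_false]
    refine intervalIntegral.integral_congr fun r _ => ?_
    simp only [hg, ← hq]
    rw [mul_left_comm, ← Real.exp_add]
    congr 2
    ring
  have hexp : Continuous fun r => g r * Real.exp (q * r) := by fun_prop
  have h1 : HasDerivAt (fun s => Real.exp (-q * s)) (-q * Real.exp (-q * t)) t :=
    ((hasDerivAt_id' t).const_mul (-q)).exp.congr_deriv (by ring)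
  have h2 := h1.mul (hexp.integral_hasStrictDerivAt 0 t).hasDerivAt
  have h3 : (fun s => jumpLaw μ ν x (n + 1) s j)
      = (fun s => Real.exp (-q * s)) * fun s => ∫ r in (0 : ℝ)..s, g r * Real.exp (q * r) :=
    funext key
  rw [h3, key t]
  refine h2.congr_deriv ?_
  have h4 : Real.exp (-q * t) * Real.exp (q * t) = 1 := by
    rw [← Real.exp_add]; simp
  change _ = _ + g t
  linear_combination (g t) * h4

theorem continuous_jumpLaw (n j : ℕ) : Continuous fun s => jumpLaw μ ν x n s j := by
  induction n generalizing j with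
  | zero =>
    rcases Nat.eq_zero_or_pos j with rfl | hj
    · simpa using continuous_const
    · exact continuous_iff_continuousAt.2 fun t => (hasDerivAt_jumpLaw_zero hj t).continuousAt
  | succ n ih =>
    rcases Nat.eq_zero_or_pos j with rfl | hj
    · simpa using continuous_const
    · exact continuous_iff_continuousAt.2 fun t =>
        (hasDerivAt_jumpLaw_succ_of_continuous ih hj t).continuousAt

theorem hasDerivAt_jumpLaw_succ (n : ℕ) {j : ℕ} (hj : 1 ≤ j) (t : ℝ) :
    HasDerivAt (fun s => jumpLaw μ ν x (n + 1) s j)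
      (-(ν j + μ j) * jumpLaw μ ν x (n + 1) t j
        + (ν (j - 1) * jumpLaw μ ν x n t (j - 1) + μ (j + 1) * jumpLaw μ ν x n t (j + 1))) t :=
  hasDerivAt_jumpLaw_succ_of_continuous (continuous_jumpLaw n) hj t

theorem jumpLaw_nonneg (hμ : ∀ j, 0 ≤ μ j) (hν : ∀ j, 0 ≤ ν j) (hx : ∀ j, 0 ≤ x j) (n : ℕ)
    {t : ℝ} (ht : 0 ≤ t) (j : ℕ) : 0 ≤ jumpLaw μ ν x n t j := by
  induction n generalizing t j with
  | zero =>
    simp only [jumpLaw]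
    split_ifs
    · exact le_rfl
    · exact mul_nonneg (hx j) (Real.exp_pos _).le
  | succ n ih =>
    simp only [jumpLaw]
    split_ifs
    · exact le_rfl
    · refine intervalIntegral.integral_nonneg ht fun s hs => ?_
      exact mul_nonneg (add_nonneg (mul_nonneg (hν _) (ih hs.1 _)) (mul_nonneg (hμ _) (ih hs.1 _)))
        (Real.exp_pos _).le

/-! ### Occupation times and weighted mass balance -/

variable (μ ν x) in
/-- The expected time spent in the state `j`, before time `t`, after exactly `n` jumps. -/
noncomputable def occupation (n : ℕ) (t : ℝ) (j : ℕ) : ℝ :=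
  ∫ s in (0 : ℝ)..t, jumpLaw μ ν x n s j

@[simp]
theorem occupation_state_zero (n : ℕ) (t : ℝ) : occupation μ ν x n t 0 = 0 := by
  simp [occupation]

theorem occupation_nonneg (hμ : ∀ j, 0 ≤ μ j) (hν : ∀ j, 0 ≤ ν j) (hx : ∀ j, 0 ≤ x j) (n : ℕ)
    {t : ℝ} (ht : 0 ≤ t) (j : ℕ) : 0 ≤ occupation μ ν x n t j :=
  intervalIntegral.integral_nonneg ht fun _ hs => jumpLaw_nonneg hμ hν hx n hs.1 j

theorem jumpLaw_zero_add_occupation {j : ℕ} (hj : 1 ≤ j) (t : ℝ) :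
    jumpLaw μ ν x 0 t j + (ν j + μ j) * occupation μ ν x 0 t j = x j := by
  have h := intervalIntegral.integral_eq_sub_of_hasDerivAt (a := 0) (b := t)
    (fun s _ => hasDerivAt_jumpLaw_zero (μ := μ) (ν := ν) (x := x) hj s)
    (((continuous_jumpLaw 0 j).const_mul _).intervalIntegrable _ _)
  rw [intervalIntegral.integral_const_mul, jumpLaw_zero_apply hj 0] at h
  simp only [mul_zero, Real.exp_zero, mul_one] at h
  unfold occupation
  linarith

/-- The integrated evolution equation: what enters `j` at jump `n + 1` is either still there or has
left by a further jump. -/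
theorem jumpLaw_succ_add_occupation (n : ℕ) {j : ℕ} (hj : 1 ≤ j) (t : ℝ) :
    jumpLaw μ ν x (n + 1) t j + (ν j + μ j) * occupation μ ν x (n + 1) t j
      = ν (j - 1) * occupation μ ν x n t (j - 1) + μ (j + 1) * occupation μ ν x n t (j + 1) := by
  have hc := fun n i c => (((continuous_jumpLaw (μ := μ) (ν := ν) (x := x) n i).const_mul c
    ).intervalIntegrable (μ := volume) 0 t)
  have h := intervalIntegral.integral_eq_sub_of_hasDerivAt (a := 0) (b := t)
    (fun s _ => hasDerivAt_jumpLaw_succ (μ := μ) (ν := ν) (x := x) n hj s)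
    ((hc _ _ _).add ((hc _ _ _).add (hc _ _ _)))
  rw [intervalIntegral.integral_add (hc _ _ _) ((hc _ _ _).add (hc _ _ _)),
    intervalIntegral.integral_add (hc _ _ _) (hc _ _ _), intervalIntegral.integral_const_mul,
    intervalIntegral.integral_const_mul, intervalIntegral.integral_const_mul,
    jumpLaw_succ_time_zero] at h
  unfold occupation
  linarith

variable (μ ν) in
/-- The q-matrix of the birth and death chain, acting on functions on the states `1, 2, …`,
extended by the value `0` at the cemetery `0`. -/
def generator (w : ℕ → ℝ) (j : ℕ) : ℝ :=
  ν j * w (j + 1) + μ j * w (j - 1) - (ν j + μ j) * w j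

variable (hμ : ∀ j, 0 ≤ μ j) (hν : ∀ j, 0 ≤ ν j) (hx : ∀ j, 0 ≤ x j)
include hμ hν hx

/-- The rates are unbounded, but rate times occupation is an expected number of departures,
controlled by the arrivals at the same jump number. This is what makes rearranging the sums over
states legitimate at each fixed `n`. -/
theorem summable_rate_mul_occupation (hxs : Summable x) (n : ℕ) {t : ℝ} (ht : 0 ≤ t) :
    Summable (fun j => ν j * occupation μ ν x n t j) ∧
      Summable (fun j => μ j * occupation μ ν x n t j) := by
  have hF := fun n j => occupation_nonneg hμ hν hx n ht j
  suffices h : Summable fun j => (ν j + μ j) * occupation μ ν x n t j by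
    constructor <;> refine Summable.of_nonneg_of_le (fun j => ?_) (fun j => ?_) h
    · exact mul_nonneg (hν j) (hF n j)
    · nlinarith [mul_nonneg (hμ j) (hF n j)]
    · exact mul_nonneg (hμ j) (hF n j)
    · nlinarith [mul_nonneg (hν j) (hF n j)]
  have hq : ∀ n j, 0 ≤ (ν j + μ j) * occupation μ ν x n t j := fun n j =>
    mul_nonneg (add_nonneg (hν j) (hμ j)) (hF n j)
  induction n with
  | zero =>
    refine Summable.of_nonneg_of_le (hq 0) (fun j => ?_) hxs
    rcases Nat.eq_zero_or_pos j with rfl | hj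
    · simpa using hx 0
    · have := jumpLaw_nonneg hμ hν hx 0 ht j
      linarith [jumpLaw_zero_add_occupation (μ := μ) (ν := ν) (x := x) hj t]
  | succ n ih =>
    refine (summable_nat_add_iff 1).1 ?_
    refine Summable.of_nonneg_of_le (fun j => hq (n + 1) (j + 1)) (fun j => ?_)
      (ih.add ((summable_nat_add_iff 2).2 ih))
    have h1 := jumpLaw_nonneg hμ hν hx (n + 1) ht (j + 1)
    have h2 := jumpLaw_succ_add_occupation (μ := μ) (ν := ν) (x := x) n (j := j + 1) (by omega) t
    simp only [Nat.add_sub_cancel] at h2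
    nlinarith [mul_nonneg (hμ j) (hF n j), mul_nonneg (hν (j + 2)) (hF n (j + 2))]

theorem summable_jumpLaw (hxs : Summable x) (n : ℕ) {t : ℝ} (ht : 0 ≤ t) :
    Summable (jumpLaw μ ν x n t) := by
  have hF := fun n j => occupation_nonneg hμ hν hx n ht j
  have hq : ∀ n j, 0 ≤ (ν j + μ j) * occupation μ ν x n t j := fun n j =>
    mul_nonneg (add_nonneg (hν j) (hμ j)) (hF n j)
  cases n with
  | zero =>
    refine Summable.of_nonneg_of_le (fun j => jumpLaw_nonneg hμ hν hx 0 ht j) (fun j => ?_) hxs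
    rcases Nat.eq_zero_or_pos j with rfl | hj
    · simpa using hx 0
    · linarith [jumpLaw_zero_add_occupation (μ := μ) (ν := ν) (x := x) hj t, hq 0 j]
  | succ n =>
    obtain ⟨h1, h2⟩ := summable_rate_mul_occupation hμ hν hx hxs n ht
    refine (summable_nat_add_iff 1).1 ?_
    refine Summable.of_nonneg_of_le (fun j => jumpLaw_nonneg hμ hν hx _ ht _) (fun j => ?_)
      (h1.add ((summable_nat_add_iff 2).2 h2))
    have h := jumpLaw_succ_add_occupation (μ := μ) (ν := ν) (x := x) n (j := j + 1) (by omega) t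
    simp only [Nat.add_sub_cancel] at h
    linarith [hq (n + 1) (j + 1)]

section Weighted

variable {w : ℕ → ℝ} {W : ℝ} (hwn : ∀ j, 0 ≤ w j) (hwW : ∀ j, w j ≤ W)

omit hμ hν hx in
include hwn hwW in
theorem summable_weight_mul {f : ℕ → ℝ} (hf : Summable f) (hfn : ∀ j, 0 ≤ f j) :
    Summable fun j => w j * f j :=
  Summable.of_nonneg_of_le (fun j => mul_nonneg (hwn j) (hfn j))
    (fun j => mul_le_mul_of_nonneg_right (hwW j) (hfn j)) (hf.mul_left W)

include hwn hwW

theorem summable_generator_mul_occupation (hxs : Summable x) (n : ℕ) {t : ℝ} (ht : 0 ≤ t) :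
    Summable (fun j => generator μ ν w j * occupation μ ν x n t j) := by
  obtain ⟨h1, h2⟩ := summable_rate_mul_occupation hμ hν hx hxs n ht
  have hF := occupation_nonneg hμ hν hx n ht
  have e1 := summable_weight_mul (w := fun j => w (j + 1)) (fun j => hwn _) (fun j => hwW _) h1
    fun j => mul_nonneg (hν j) (hF j)
  have e2 := summable_weight_mul (w := fun j => w (j - 1)) (fun j => hwn _) (fun j => hwW _) h2
    fun j => mul_nonneg (hμ j) (hF j)
  have e3 := summable_weight_mul hwn hwW (h1.add h2)
    fun j => add_nonneg (mul_nonneg (hν j) (hF j)) (mul_nonneg (hμ j) (hF j))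
  refine ((e1.add e2).sub e3).congr fun j => ?_
  unfold generator
  ring

/-- The weighted mass balance at the jump number `n + 1`. -/
theorem tsum_weight_mul_jumpLaw_succ (hw0 : w 0 = 0) (hxs : Summable x) (n : ℕ) {t : ℝ}
    (ht : 0 ≤ t) :
    ∑' j, w j * jumpLaw μ ν x (n + 1) t j
        + ∑' j, w j * ((ν j + μ j) * occupation μ ν x (n + 1) t j)
      = ∑' j, w j * ((ν j + μ j) * occupation μ ν x n t j)
        + ∑' j, generator μ ν w j * occupation μ ν x n t j := by
  have hF := fun n => occupation_nonneg hμ hν hx n ht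
  have hs : ∀ n, Summable fun j => w j * ((ν j + μ j) * occupation μ ν x n t j) := fun n => by
    obtain ⟨h1, h2⟩ := summable_rate_mul_occupation hμ hν hx hxs n ht
    refine summable_weight_mul hwn hwW ((h1.add h2).congr fun j => (add_mul _ _ _).symm)
      fun j => mul_nonneg (add_nonneg (hν j) (hμ j)) (hF n j)
  obtain ⟨h1, h2⟩ := summable_rate_mul_occupation hμ hν hx hxs n ht
  -- Summation by parts: index shifts move the difference operator from the occupation times to `w`.
  -- The boundary terms vanish because `w 0 = 0` and the occupation of `0` is zero.
  have e1 := summable_weight_mul (w := fun j => w (j + 1)) (fun j => hwn _) (fun j => hwW _) h1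
    fun j => mul_nonneg (hν j) (hF n j)
  have e2 := summable_weight_mul (w := fun j => w (j - 1)) (fun j => hwn _) (fun j => hwW _) h2
    fun j => mul_nonneg (hμ j) (hF n j)
  have e3 := (summable_nat_add_iff 1).2 e2
  have e4 : Summable fun j => w j * (ν (j - 1) * occupation μ ν x n t (j - 1)) :=
    (summable_nat_add_iff 1).1 (by simpa using e1)
  have t4 := e4.tsum_eq_zero_add
  have t2 := e2.tsum_eq_zero_add
  simp only [hw0, zero_mul, zero_add, Nat.add_sub_cancel, occupation_state_zero, mul_zero]
    at t4 t2 e3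
  rw [← (summable_weight_mul hwn hwW (summable_jumpLaw hμ hν hx hxs (n + 1) ht)
      (jumpLaw_nonneg hμ hν hx _ ht)).tsum_add (hs _),
    ← (hs n).tsum_add (summable_generator_mul_occupation hμ hν hx hwn hwW hxs n ht)]
  calc _ = ∑' j, (w j * (ν (j - 1) * occupation μ ν x n t (j - 1))
          + w j * (μ (j + 1) * occupation μ ν x n t (j + 1))) := by
        refine tsum_congr fun j => ?_
        rcases Nat.eq_zero_or_pos j with rfl | hj
        · simp [hw0]
        · rw [← mul_add, jumpLaw_succ_add_occupation n hj, mul_add]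
    _ = ∑' j, (w (j + 1) * (ν j * occupation μ ν x n t j)
          + w (j - 1) * (μ j * occupation μ ν x n t j)) := by
        rw [e4.tsum_add e3, e1.tsum_add e2, t4, t2]
    _ = _ := tsum_congr fun j => by unfold generator; ring

/-- Summing the weighted mass balance over the first `N + 1` jump numbers. -/
theorem sum_tsum_weight_mul_jumpLaw (hw0 : w 0 = 0) (hxs : Summable x) (N : ℕ) {t : ℝ}
    (ht : 0 ≤ t) :
    ∑ n ∈ range (N + 1), ∑' j, w j * jumpLaw μ ν x n t j
        + ∑' j, w j * ((ν j + μ j) * occupation μ ν x N t j)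
      = ∑' j, w j * x j
        + ∑ n ∈ range N, ∑' j, generator μ ν w j * occupation μ ν x n t j := by
  induction N with
  | zero =>
    obtain ⟨h1, h2⟩ := summable_rate_mul_occupation hμ hν hx hxs 0 ht
    have hs := summable_weight_mul hwn hwW ((h1.add h2).congr fun j => (add_mul _ _ _).symm)
      fun j => mul_nonneg (add_nonneg (hν j) (hμ j)) (occupation_nonneg hμ hν hx 0 ht j)
    rw [zero_add, sum_range_one, sum_range_zero, add_zero,
      ← (summable_weight_mul hwn hwW (summable_jumpLaw hμ hν hx hxs 0 ht)
      (jumpLaw_nonneg hμ hν hx _ ht)).tsum_add hs]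
    refine tsum_congr fun j => ?_
    rcases Nat.eq_zero_or_pos j with rfl | hj
    · simp [hw0]
    · rw [← mul_add, jumpLaw_zero_add_occupation hj]
  | succ N ih =>
    have h := tsum_weight_mul_jumpLaw_succ hμ hν hx hwn hwW hw0 hxs N ht
    rw [sum_range_succ, sum_range_succ (fun n => ∑' j, generator μ ν w j * occupation μ ν x n t j)]
    linarith

/-- If `w` is superharmonic, the accumulated loss of `w`-mass is at most the initial `w`-mass. -/
theorem sum_tsum_neg_generator_mul_occupation_le (hw0 : w 0 = 0) (hxs : Summable x) (N : ℕ)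
    {t : ℝ} (ht : 0 ≤ t) :
    ∑ n ∈ range N, ∑' j, -generator μ ν w j * occupation μ ν x n t j ≤ ∑' j, w j * x j := by
  have h := sum_tsum_weight_mul_jumpLaw hμ hν hx hwn hwW hw0 hxs N ht
  have h1 : 0 ≤ ∑ n ∈ range (N + 1), ∑' j, w j * jumpLaw μ ν x n t j :=
    sum_nonneg fun n _ => tsum_nonneg fun j =>
      mul_nonneg (hwn j) (jumpLaw_nonneg hμ hν hx n ht j)
  have h2 : 0 ≤ ∑' j, w j * ((ν j + μ j) * occupation μ ν x N t j) := tsum_nonneg fun j =>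
    mul_nonneg (hwn j) (mul_nonneg (add_nonneg (hν j) (hμ j)) (occupation_nonneg hμ hν hx N ht j))
  simp only [neg_mul, tsum_neg, sum_neg_distrib]
  linarith

end Weighted

/-- Together the states carry at most the initial mass, over any number of jumps. -/
theorem sum_tsum_jumpLaw_le (hxs : Summable x) (N : ℕ) {t : ℝ} (ht : 0 ≤ t) :
    ∑ n ∈ range N, ∑' j, jumpLaw μ ν x n t j ≤ ∑' j, x j := by
  -- The indicator of the living states is superharmonic: its only loss is the killing from `1`.
  set w : ℕ → ℝ := fun j => if j = 0 then 0 else 1 with hw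
  have hwn : ∀ j, 0 ≤ w j := fun j => by simp only [hw]; split_ifs <;> norm_num
  have hwW : ∀ j, w j ≤ 1 := fun j => by simp only [hw]; split_ifs <;> norm_num
  have hw0 : w 0 = 0 := by simp [hw]
  have hG : ∀ j, 1 ≤ j → generator μ ν w j ≤ 0 := fun j hj => by
    have h1 : w j = 1 := if_neg (by omega)
    have h2 : w (j + 1) = 1 := if_neg (by omega)
    unfold generator
    rw [h1, h2]
    linarith [mul_le_mul_of_nonneg_left (hwW (j - 1)) (hμ j)]
  have h := sum_tsum_weight_mul_jumpLaw hμ hν hx hwn hwW hw0 hxs N ht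
  have h1 : ∀ n, ∑' j, w j * jumpLaw μ ν x n t j = ∑' j, jumpLaw μ ν x n t j := fun n =>
    tsum_congr fun j => by
      rcases Nat.eq_zero_or_pos j with rfl | hj
      · simp
      · simp [hw, Nat.ne_of_gt hj]
  have h2 : 0 ≤ ∑' j, w j * ((ν j + μ j) * occupation μ ν x N t j) := tsum_nonneg fun j =>
    mul_nonneg (hwn j) (mul_nonneg (add_nonneg (hν j) (hμ j)) (occupation_nonneg hμ hν hx N ht j))
  have h3 : ∑ n ∈ range N, ∑' j, generator μ ν w j * occupation μ ν x n t j ≤ 0 :=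
    sum_nonpos fun n _ => tsum_nonpos fun j => by
      rcases Nat.eq_zero_or_pos j with rfl | hj
      · simp
      · exact mul_nonpos_of_nonpos_of_nonneg (hG j hj) (occupation_nonneg hμ hν hx n ht j)
  have h4 : ∑' j, w j * x j ≤ ∑' j, x j :=
    (summable_weight_mul hwn hwW hxs hx).tsum_le_tsum
      (fun j => mul_le_of_le_one_left (hx j) (hwW j)) hxs
  have h5 : 0 ≤ ∑' j, jumpLaw μ ν x N t j := tsum_nonneg (jumpLaw_nonneg hμ hν hx N ht)
  simp only [h1, sum_range_succ] at h
  linarith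

end JumpLaw

/-! ### Calculus on the half-line -/

section Primitive

theorem intervalIntegrable_of_continuousOn_Ici {g : ℝ → ℝ} (hg : ContinuousOn g (Set.Ici 0))
    {t : ℝ} (ht : 0 ≤ t) : IntervalIntegrable g volume 0 t :=
  ContinuousOn.intervalIntegrable (hg.mono (by
    rw [Set.uIcc_of_le ht]; exact Set.Icc_subset_Ici_self))

theorem hasDerivWithinAt_primitive_Ici {g : ℝ → ℝ} (hg : ContinuousOn g (Set.Ici 0)) {t : ℝ}
    (ht : 0 ≤ t) : HasDerivWithinAt (fun u => ∫ s in (0 : ℝ)..u, g s) (g t) (Set.Ici 0) t := by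
  -- Freezing `g` at its value in `0` for negative times gives a function continuous on the whole
  -- line with the same primitive on `[0, ∞)`.
  have hc : Continuous fun s => g (max s 0) :=
    hg.comp_continuous (by fun_prop) fun s => le_max_right s 0
  have h := (hc.integral_hasStrictDerivAt 0 t).hasDerivAt.hasDerivWithinAt (s := Set.Ici 0)
  rw [max_eq_left ht] at h
  refine h.congr_of_mem (fun u hu => ?_) ht
  refine intervalIntegral.integral_congr fun s hs => ?_
  rw [Set.uIcc_of_le hu] at hs
  simp only [max_eq_left hs.1]

/-- The fundamental theorem of calculus on `[0, ∞)`, with a one-sided derivative at `0`. -/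
theorem integral_eq_sub_of_hasDerivWithinAt_Ici {f f' : ℝ → ℝ}
    (hf : ∀ t, 0 ≤ t → HasDerivWithinAt f (f' t) (Set.Ici 0) t)
    (hf' : ContinuousOn f' (Set.Ici 0)) {t : ℝ} (ht : 0 ≤ t) :
    ∫ s in (0 : ℝ)..t, f' s = f t - f 0 := by
  refine intervalIntegral.integral_eq_sub_of_hasDerivAt_of_le ht
    (fun s hs => ((hf s hs.1).continuousWithinAt.mono Set.Icc_subset_Ici_self))
    (fun s hs => (hf s hs.1.le).hasDerivAt (Ici_mem_nhds hs.1))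
    (intervalIntegrable_of_continuousOn_Ici hf' ht)

/-- A differential inequality `f' ≥ -q f` preserves positivity. -/
theorem nonneg_of_hasDerivWithinAt_ge_neg_mul {f g : ℝ → ℝ} {q : ℝ}
    (hf : ∀ t, 0 ≤ t → HasDerivWithinAt f (-q * f t + g t) (Set.Ici 0) t)
    (hg : ∀ t, 0 ≤ t → 0 ≤ g t) (h0 : 0 ≤ f 0) {t : ℝ} (ht : 0 ≤ t) : 0 ≤ f t := by
  have hd : ∀ s, 0 ≤ s → HasDerivWithinAt (fun s => Real.exp (q * s) * f s)
      (Real.exp (q * s) * g s) (Set.Ici 0) s := fun s hs => by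
    have h1 : HasDerivAt (fun s => Real.exp (q * s)) (q * Real.exp (q * s)) s :=
      ((hasDerivAt_id' s).const_mul q).exp.congr_deriv (by ring)
    exact (h1.hasDerivWithinAt.mul (hf s hs)).congr_deriv (by ring)
  have hm : MonotoneOn (fun s => Real.exp (q * s) * f s) (Set.Ici 0) := by
    refine monotoneOn_of_hasDerivWithinAt_nonneg (convex_Ici 0)
      (fun s hs => (hd s hs).continuousWithinAt)
      (fun s hs => (hd s (interior_subset hs)).mono interior_subset)
      fun s hs => mul_nonneg (Real.exp_pos _).le (hg s (interior_subset hs))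
  have h := hm (Set.mem_Ici.2 le_rfl) (Set.mem_Ici.2 ht) ht
  simp only [mul_zero, Real.exp_zero, one_mul] at h
  exact nonneg_of_mul_nonneg_right (h0.trans h) (Real.exp_pos _)

end Primitive

/-! ### The minimal law solves the forward equation -/

section MinimalLaw

variable {μ ν x : ℕ → ℝ}

variable (μ ν x) in
/-- The probability to be at `j` at time `t` after fewer than `N` jumps. -/
noncomputable def partialLaw (N : ℕ) (t : ℝ) (j : ℕ) : ℝ :=
  ∑ n ∈ range N, jumpLaw μ ν x n t j

theorem hasDerivAt_partialLaw_succ (N : ℕ) {j : ℕ} (hj : 1 ≤ j) (t : ℝ) :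
    HasDerivAt (fun s => partialLaw μ ν x (N + 1) s j)
      (-(ν j + μ j) * partialLaw μ ν x (N + 1) t j
        + (ν (j - 1) * partialLaw μ ν x N t (j - 1)
          + μ (j + 1) * partialLaw μ ν x N t (j + 1))) t := by
  unfold partialLaw
  simp only [sum_range_succ']
  refine ((HasDerivAt.fun_sum fun n _ => hasDerivAt_jumpLaw_succ n hj t).add
    (hasDerivAt_jumpLaw_zero hj t)).congr_deriv ?_
  simp only [sum_add_distrib, ← mul_sum]
  ring

theorem partialLaw_succ_time_zero (N : ℕ) {j : ℕ} (hj : 1 ≤ j) :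
    partialLaw μ ν x (N + 1) 0 j = x j := by
  simp [partialLaw, sum_range_succ', jumpLaw_succ_time_zero, jumpLaw_zero_apply hj]

theorem continuous_partialLaw (N j : ℕ) : Continuous fun s => partialLaw μ ν x N s j :=
  continuous_finsetSum _ fun n _ => continuous_jumpLaw n j

theorem partialLaw_state_zero (N : ℕ) (t : ℝ) : partialLaw μ ν x N t 0 = 0 := by
  simp [partialLaw]

theorem integral_partialLaw (N : ℕ) (t : ℝ) (j : ℕ) :
    ∫ s in (0 : ℝ)..t, partialLaw μ ν x N s j = ∑ n ∈ range N, occupation μ ν x n t j :=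
  intervalIntegral.integral_finsetSum fun n _ => (continuous_jumpLaw n j).intervalIntegrable _ _

theorem minimalLaw_state_zero (t : ℝ) : minimalLaw μ ν x t 0 = 0 := by
  simp [minimalLaw]

variable (hμ : ∀ j, 0 ≤ μ j) (hν : ∀ j, 0 ≤ ν j) (hx : ∀ j, 0 ≤ x j)
include hμ hν hx

theorem partialLaw_nonneg (N : ℕ) {t : ℝ} (ht : 0 ≤ t) (j : ℕ) : 0 ≤ partialLaw μ ν x N t j :=
  sum_nonneg fun n _ => jumpLaw_nonneg hμ hν hx n ht j

theorem minimalLaw_nonneg {t : ℝ} (ht : 0 ≤ t) (j : ℕ) : 0 ≤ minimalLaw μ ν x t j :=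
  tsum_nonneg fun n => jumpLaw_nonneg hμ hν hx n ht j

variable (hxs : Summable x)
include hxs

theorem sum_partialLaw_le (s : Finset ℕ) (N : ℕ) {t : ℝ} (ht : 0 ≤ t) :
    ∑ j ∈ s, partialLaw μ ν x N t j ≤ ∑' j, x j := by
  refine le_trans ?_ (sum_tsum_jumpLaw_le hμ hν hx hxs N ht)
  unfold partialLaw
  rw [sum_comm]
  exact sum_le_sum fun n _ => (summable_jumpLaw hμ hν hx hxs n ht).sum_le_tsum s
    fun j _ => jumpLaw_nonneg hμ hν hx n ht j

theorem partialLaw_le (N : ℕ) {t : ℝ} (ht : 0 ≤ t) (j : ℕ) :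
    partialLaw μ ν x N t j ≤ ∑' j, x j := by
  simpa using sum_partialLaw_le hμ hν hx hxs {j} N ht

theorem tendsto_partialLaw {t : ℝ} (ht : 0 ≤ t) (j : ℕ) :
    Tendsto (fun N => partialLaw μ ν x N t j) atTop (𝓝 (minimalLaw μ ν x t j)) :=
  (summable_of_sum_range_le (fun n => jumpLaw_nonneg hμ hν hx n ht j)
    fun N => partialLaw_le hμ hν hx hxs N ht j).hasSum.tendsto_sum_nat

theorem sum_minimalLaw_le (s : Finset ℕ) {t : ℝ} (ht : 0 ≤ t) :
    ∑ j ∈ s, minimalLaw μ ν x t j ≤ ∑' j, x j :=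
  le_of_tendsto' (tendsto_finsetSum s fun j _ => tendsto_partialLaw hμ hν hx hxs ht j)
    fun N => sum_partialLaw_le hμ hν hx hxs s N ht

theorem summable_minimalLaw {t : ℝ} (ht : 0 ≤ t) : Summable (minimalLaw μ ν x t) :=
  summable_of_sum_le (minimalLaw_nonneg hμ hν hx ht) fun s => sum_minimalLaw_le hμ hν hx hxs s ht

theorem tsum_minimalLaw_le {t : ℝ} (ht : 0 ≤ t) : ∑' j, minimalLaw μ ν x t j ≤ ∑' j, x j :=
  Real.tsum_le_of_sum_le (minimalLaw_nonneg hμ hν hx ht)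
    fun s => sum_minimalLaw_le hμ hν hx hxs s ht

/-- For fixed `j` only three states enter the derivative of a partial sum, so its bound is uniform
in `N` and passes to the limit. The resulting continuity allows the integrated equation to be
differentiated. -/
theorem abs_minimalLaw_sub_le {j : ℕ} (hj : 1 ≤ j) {s t : ℝ} (hs : 0 ≤ s) (ht : 0 ≤ t) :
    |minimalLaw μ ν x t j - minimalLaw μ ν x s j|
      ≤ (ν j + μ j + ν (j - 1) + μ (j + 1)) * (∑' j, x j) * |t - s| := by
  refine le_of_tendsto' (((tendsto_add_atTop_iff_nat 1).2
    ((tendsto_partialLaw hμ hν hx hxs ht j).sub (tendsto_partialLaw hμ hν hx hxs hs j))).abs)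
    fun N => ?_
  refine Convex.norm_image_sub_le_of_norm_hasDerivWithin_le
    (fun r _ => (hasDerivAt_partialLaw_succ N hj r).hasDerivWithinAt) (fun r hr => ?_)
    (convex_Ici 0) hs ht
  have a1 := mul_le_mul_of_nonneg_left (partialLaw_le hμ hν hx hxs (N + 1) hr j)
    (add_nonneg (hν j) (hμ j))
  have a2 := mul_le_mul_of_nonneg_left (partialLaw_le hμ hν hx hxs N hr (j - 1)) (hν (j - 1))
  have a3 := mul_le_mul_of_nonneg_left (partialLaw_le hμ hν hx hxs N hr (j + 1)) (hμ (j + 1))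
  have b1 := mul_nonneg (add_nonneg (hν j) (hμ j)) (partialLaw_nonneg hμ hν hx (N + 1) hr j)
  have b2 := mul_nonneg (hν (j - 1)) (partialLaw_nonneg hμ hν hx N hr (j - 1))
  have b3 := mul_nonneg (hμ (j + 1)) (partialLaw_nonneg hμ hν hx N hr (j + 1))
  rw [Real.norm_eq_abs, abs_le]
  constructor <;> linarith

theorem continuousOn_minimalLaw (j : ℕ) :
    ContinuousOn (fun t => minimalLaw μ ν x t j) (Set.Ici 0) := by
  rcases Nat.eq_zero_or_pos j with rfl | hj
  · simpa only [minimalLaw_state_zero] using continuousOn_const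
  · refine LipschitzOnWith.continuousOn
      (K := ((ν j + μ j + ν (j - 1) + μ (j + 1)) * ∑' j, x j).toNNReal) ?_
    refine LipschitzOnWith.of_dist_le_mul fun t ht s hs => ?_
    rw [Real.dist_eq, Real.dist_eq]
    exact (abs_minimalLaw_sub_le hμ hν hx hxs hj hs ht).trans
      (mul_le_mul_of_nonneg_right (Real.le_coe_toNNReal _) (abs_nonneg _))

theorem tendsto_integral_partialLaw {t : ℝ} (ht : 0 ≤ t) (j : ℕ) :
    Tendsto (fun N => ∫ s in (0 : ℝ)..t, partialLaw μ ν x N s j) atTop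
      (𝓝 (∫ s in (0 : ℝ)..t, minimalLaw μ ν x s j)) := by
  refine intervalIntegral.tendsto_integral_filter_of_dominated_convergence
    (fun _ => ∑' j, x j) ?_ ?_ intervalIntegrable_const ?_
  · exact Eventually.of_forall fun N => (continuous_partialLaw N j).aestronglyMeasurable
  · refine Eventually.of_forall fun N => Eventually.of_forall fun s hs => ?_
    rw [Set.uIoc_of_le ht] at hs
    rw [Real.norm_of_nonneg (partialLaw_nonneg hμ hν hx N hs.1.le j)]
    exact partialLaw_le hμ hν hx hxs N hs.1.le j
  · refine Eventually.of_forall fun s hs => ?_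
    rw [Set.uIoc_of_le ht] at hs
    exact tendsto_partialLaw hμ hν hx hxs hs.1.le j

theorem minimalLaw_time_zero {j : ℕ} (hj : 1 ≤ j) : minimalLaw μ ν x 0 j = x j := by
  refine tendsto_nhds_unique ((tendsto_add_atTop_iff_nat 1).2
    (tendsto_partialLaw hμ hν hx hxs le_rfl j)) ?_
  simpa only [partialLaw_succ_time_zero _ hj] using tendsto_const_nhds

/-- The integrated forward equation of the minimal law. -/
theorem minimalLaw_eq_add_integral {j : ℕ} (hj : 1 ≤ j) {t : ℝ} (ht : 0 ≤ t) :
    minimalLaw μ ν x t j = x j + ∫ s in (0 : ℝ)..t, (-(ν j + μ j) * minimalLaw μ ν x s j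
      + ν (j - 1) * minimalLaw μ ν x s (j - 1) + μ (j + 1) * minimalLaw μ ν x s (j + 1)) := by
  have hS := fun N i c => (((continuous_partialLaw (μ := μ) (ν := ν) (x := x) N i).const_mul c
    ).intervalIntegrable (μ := volume) 0 t)
  have hM := fun i c => (intervalIntegrable_of_continuousOn_Ici
    (continuousOn_minimalLaw hμ hν hx hxs i) ht).const_mul c
  have h1 : ∀ N, partialLaw μ ν x (N + 1) t j
      = x j + (-(ν j + μ j) * (∫ s in (0 : ℝ)..t, partialLaw μ ν x (N + 1) s j)
        + ν (j - 1) * (∫ s in (0 : ℝ)..t, partialLaw μ ν x N s (j - 1))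
        + μ (j + 1) * ∫ s in (0 : ℝ)..t, partialLaw μ ν x N s (j + 1)) := fun N => by
    have h := intervalIntegral.integral_eq_sub_of_hasDerivAt (a := 0) (b := t)
      (fun s _ => hasDerivAt_partialLaw_succ (μ := μ) (ν := ν) (x := x) N hj s)
      ((hS _ _ _).add ((hS _ _ _).add (hS _ _ _)))
    rw [intervalIntegral.integral_add (hS _ _ _) ((hS _ _ _).add (hS _ _ _)),
      intervalIntegral.integral_add (hS _ _ _) (hS _ _ _), intervalIntegral.integral_const_mul,
      intervalIntegral.integral_const_mul, intervalIntegral.integral_const_mul,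
      partialLaw_succ_time_zero N hj] at h
    linarith
  rw [intervalIntegral.integral_add ((hM _ _).add (hM _ _)) (hM _ _),
    intervalIntegral.integral_add (hM _ _) (hM _ _), intervalIntegral.integral_const_mul,
    intervalIntegral.integral_const_mul, intervalIntegral.integral_const_mul]
  refine tendsto_nhds_unique ((tendsto_add_atTop_iff_nat 1).2
    (tendsto_partialLaw hμ hν hx hxs ht j)) ?_
  simp only [h1]
  have hI := tendsto_integral_partialLaw hμ hν hx hxs ht
  exact (((((tendsto_add_atTop_iff_nat 1).2 (hI j)).const_mul _).add ((hI _).const_mul _)).add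
    ((hI _).const_mul _)).const_add _

theorem isForwardSolution_minimalLaw : IsForwardSolution μ ν x (minimalLaw μ ν x) where
  boundary t _ := minimalLaw_state_zero t
  initial j hj := minimalLaw_time_zero hμ hν hx hxs hj
  forward j hj t ht := by
    have hc := fun i c => (continuousOn_minimalLaw hμ hν hx hxs i).const_smul (c := (c : ℝ))
    have h := (hasDerivWithinAt_primitive_Ici (((hc j (-(ν j + μ j))).add
      (hc (j - 1) (ν (j - 1)))).add (hc (j + 1) (μ (j + 1)))) ht).const_add (x j)
    exact h.congr_of_mem (fun s hs => minimalLaw_eq_add_integral hμ hν hx hxs hj hs) ht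
  nonneg t ht j := minimalLaw_nonneg hμ hν hx ht j
  summable t ht := summable_minimalLaw hμ hν hx hxs ht
  bounded T _ := ⟨∑' j, x j, fun t ht _ => tsum_minimalLaw_le hμ hν hx hxs ht⟩

end MinimalLaw

/-! ### Uniqueness for symmetric rates -/

section Uniqueness

variable {μ ν x : ℕ → ℝ}

/-- The minimal law is the smallest solution: any solution dominates its partial sums. -/
theorem IsForwardSolution.partialLaw_le {e : ℝ → ℕ → ℝ} (he : IsForwardSolution μ ν x e)
    (hμ : ∀ j, 0 ≤ μ j) (hν : ∀ j, 0 ≤ ν j) (N : ℕ) {t : ℝ} (ht : 0 ≤ t) (j : ℕ) :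
    partialLaw μ ν x N t j ≤ e t j := by
  induction N generalizing t j with
  | zero => simpa [partialLaw] using he.nonneg t ht j
  | succ N ih =>
    rcases Nat.eq_zero_or_pos j with rfl | hj
    · rw [partialLaw_state_zero]
      exact he.nonneg t ht 0
    · refine sub_nonneg.1 (nonneg_of_hasDerivWithinAt_ge_neg_mul
        (f := fun s => e s j - partialLaw μ ν x (N + 1) s j) (q := ν j + μ j)
        (g := fun s => ν (j - 1) * (e s (j - 1) - partialLaw μ ν x N s (j - 1))
          + μ (j + 1) * (e s (j + 1) - partialLaw μ ν x N s (j + 1)))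
        (fun s hs => ?_) (fun s hs => ?_) ?_ ht)
      · exact ((he.forward j hj s hs).sub
          (hasDerivAt_partialLaw_succ N hj s).hasDerivWithinAt).congr_deriv (by ring)
      · exact add_nonneg (mul_nonneg (hν _) (sub_nonneg.2 (ih hs _)))
          (mul_nonneg (hμ _) (sub_nonneg.2 (ih hs _)))
      · simp [partialLaw_succ_time_zero N hj, he.initial j hj]

theorem IsForwardSolution.continuousOn {e : ℝ → ℕ → ℝ} (he : IsForwardSolution μ ν x e) (j : ℕ) :
    ContinuousOn (fun t => e t j) (Set.Ici 0) := by
  rcases Nat.eq_zero_or_pos j with rfl | hj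
  · exact continuousOn_const.congr fun t ht => he.boundary t ht
  · exact fun t ht => (he.forward j hj t ht).continuousWithinAt

/-- The difference of two comparable solutions solves the equation with zero initial value. -/
theorem IsForwardSolution.sub {e f : ℝ → ℕ → ℝ} (he : IsForwardSolution μ ν x e)
    (hf : IsForwardSolution μ ν x f) (hle : ∀ t, 0 ≤ t → ∀ j, f t j ≤ e t j) :
    IsForwardSolution μ ν 0 (fun t j => e t j - f t j) where
  boundary t ht := by simp [he.boundary t ht, hf.boundary t ht]
  initial j hj := by simp [he.initial j hj, hf.initial j hj]
  forward j hj t ht :=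
    ((he.forward j hj t ht).sub (hf.forward j hj t ht)).congr_deriv (by ring)
  nonneg t ht j := sub_nonneg.2 (hle t ht j)
  summable t ht := (he.summable t ht).sub (hf.summable t ht)
  bounded T hT := by
    obtain ⟨C, hC⟩ := he.bounded T hT
    refine ⟨C, fun t ht htT => le_trans ?_ (hC t ht htT)⟩
    exact ((he.summable t ht).sub (hf.summable t ht)).tsum_le_tsum
      (fun j => sub_le_self _ (hf.nonneg t ht j)) (he.summable t ht)

/-- For symmetric rates, a solution started from zero vanishes: its time integrals are nonnegative,
nondecreasing in the state, and summable. -/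
theorem IsForwardSolution.eq_zero {d : ℝ → ℕ → ℝ} (hd : IsForwardSolution μ ν 0 d)
    (hμ : ∀ j, 0 ≤ μ j) (hpos : ∀ j, 1 ≤ j → 0 < ν j) (hsymm : ∀ j, 1 ≤ j → μ (j + 1) = ν j)
    {t : ℝ} (ht : 0 ≤ t) (j : ℕ) : d t j = 0 := by
  set D : ℕ → ℝ := fun j => ∫ s in (0 : ℝ)..t, d s j with hD
  have hint : ∀ j, IntervalIntegrable (fun s => d s j) volume 0 t := fun j =>
    intervalIntegrable_of_continuousOn_Ici (hd.continuousOn j) ht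
  have hD0 : ∀ j, 0 ≤ D j := fun j =>
    intervalIntegral.integral_nonneg ht fun s hs => hd.nonneg s hs.1 j
  have heq : ∀ j, 1 ≤ j →
      d t j = -(ν j + μ j) * D j + ν (j - 1) * D (j - 1) + μ (j + 1) * D (j + 1) := fun j hj => by
    have hc := fun i c => (hd.continuousOn i).const_smul (c := (c : ℝ))
    have h := integral_eq_sub_of_hasDerivWithinAt_Ici (hd.forward j hj)
      (((hc j (-(ν j + μ j))).add (hc (j - 1) (ν (j - 1)))).add (hc (j + 1) (μ (j + 1)))) ht
    rw [intervalIntegral.integral_add (((hint _).const_mul _).add ((hint _).const_mul _))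
      ((hint _).const_mul _), intervalIntegral.integral_add ((hint _).const_mul _)
      ((hint _).const_mul _), intervalIntegral.integral_const_mul,
      intervalIntegral.integral_const_mul, intervalIntegral.integral_const_mul,
      hd.initial j hj] at h
    simp only [Pi.zero_apply, sub_zero] at h
    exact h.symm
  have hD_zero : D 0 = 0 := by
    rw [hD]
    refine (intervalIntegral.integral_congr fun s hs => ?_).trans intervalIntegral.integral_zero
    rw [Set.uIcc_of_le ht] at hs
    exact hd.boundary s hs.1
  -- By symmetry `d t j` is the increment of the flux at `j`. At `j = 1` the flux equals `d t 1 + μ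
  -- 1 * D 1`, since `D 0 = 0`.
  have hflux : ∀ j, 0 ≤ ν (j + 1) * (D (j + 2) - D (j + 1)) := fun j => by
    induction j with
    | zero =>
      have h := heq 1 le_rfl
      have h1 := hsymm 1 le_rfl
      have h2 := hd.nonneg t ht 1
      have h3 := mul_nonneg (hμ 1) (hD0 1)
      simp only [Nat.sub_self, hD_zero, Nat.reduceAdd] at h h1
      rw [h1] at h
      simp only [zero_add]
      linarith
    | succ j ih =>
      have h := heq (j + 2) (by omega)
      have h1 := hsymm (j + 1) (by omega)
      have h2 := hsymm (j + 2) (by omega)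
      have h3 := hd.nonneg t ht (j + 2)
      simp only [show j + 2 - 1 = j + 1 by omega, show j + 1 + 1 = j + 2 by omega,
        show j + 1 + 2 = j + 3 by omega] at h h1 h2 ⊢
      rw [h2, h1] at h
      linarith
  have hmono : Monotone fun j => D (j + 1) := monotone_nat_of_le_succ fun j =>
    sub_nonneg.1 (nonneg_of_mul_nonneg_right (hflux j) (hpos (j + 1) (by omega)))
  have hsum : Summable D := by
    obtain ⟨C, hC⟩ := hd.bounded t ht
    refine summable_of_sum_range_le (c := C * t) hD0 fun n => ?_
    rw [hD, ← intervalIntegral.integral_finsetSum fun j _ => hint j]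
    calc _ ≤ ∫ _ in (0 : ℝ)..t, C := by
          refine intervalIntegral.integral_mono_on ht ?_ intervalIntegrable_const fun s hs => ?_
          · exact intervalIntegrable_of_continuousOn_Ici
              (continuousOn_finsetSum _ fun j _ => hd.continuousOn j) ht
          · exact ((hd.summable s hs.1).sum_le_tsum _ fun j _ => hd.nonneg s hs.1 j).trans
              (hC s hs.1 hs.2)
      _ = C * t := by simp [mul_comm]
  have hDz : ∀ j, D j = 0 := fun j => by
    rcases j with _ | j
    · exact hD_zero
    -- A nondecreasing sequence stays below its limit, which is `0` by summability.
    · exact le_antisymm (hmono.ge_of_tendsto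
        ((tendsto_add_atTop_iff_nat 1).2 hsum.tendsto_atTop_zero) j) (hD0 _)
  rcases Nat.eq_zero_or_pos j with rfl | hj
  · exact hd.boundary t ht
  · simp [heq j hj, hDz]

theorem IsForwardSolution.eq_minimalLaw {e : ℝ → ℕ → ℝ} (he : IsForwardSolution μ ν x e)
    (hμ : ∀ j, 0 ≤ μ j) (hν : ∀ j, 0 ≤ ν j) (hx : ∀ j, 0 ≤ x j) (hxs : Summable x)
    (hpos : ∀ j, 1 ≤ j → 0 < ν j) (hsymm : ∀ j, 1 ≤ j → μ (j + 1) = ν j)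
    {t : ℝ} (ht : 0 ≤ t) (j : ℕ) : e t j = minimalLaw μ ν x t j :=
  sub_eq_zero.1 ((he.sub (isForwardSolution_minimalLaw hμ hν hx hxs) fun _ hs i =>
    le_of_tendsto' (tendsto_partialLaw hμ hν hx hxs hs i)
      fun N => he.partialLaw_le hμ hν N hs i).eq_zero hμ hpos hsymm ht j)

end Uniqueness

/-! ### Explosion from a Lyapunov function -/

section Explosion

variable {μ ν x w : ℕ → ℝ} {b ε : ℝ}

/-- Under a Lyapunov function `w ≤ b` whose generator is at most `-ε`, with the killing rate as an
additional margin at `1`, the killing probability plus `ε` times the lifetime is at most `b`. -/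
theorem killing_add_lifetime_le (hμ : ∀ j, 0 ≤ μ j) (hν : ∀ j, 0 ≤ ν j) (hx : ∀ j, 0 ≤ x j)
    (hx1 : HasSum x 1) (hw0 : w 0 = 0) (hwn : ∀ j, 0 ≤ w j) (hwb : ∀ j, w j ≤ b) (hε : 0 ≤ ε)
    (hgen : ∀ j, 1 ≤ j → generator μ ν w j ≤ -(ε + if j = 1 then μ 1 else 0))
    (J : ℕ) {t : ℝ} (ht : 0 ≤ t) :
    μ 1 * (∫ s in (0 : ℝ)..t, minimalLaw μ ν x s 1)
      + ε * ∑ j ∈ range (J + 2), ∫ s in (0 : ℝ)..t, minimalLaw μ ν x s j ≤ b := by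
  have hI := tendsto_integral_partialLaw hμ hν hx hx1.summable ht
  refine le_of_tendsto' (((hI 1).const_mul (μ 1)).add
    ((tendsto_finsetSum _ fun j _ => hI j).const_mul ε)) fun N => ?_
  have hF := fun n => occupation_nonneg hμ hν hx n ht
  have hpt : ∀ n j, (ε + if j = 1 then μ 1 else 0) * occupation μ ν x n t j
      ≤ -generator μ ν w j * occupation μ ν x n t j := fun n j => by
    rcases Nat.eq_zero_or_pos j with rfl | hj
    · simp
    · exact mul_le_mul_of_nonneg_right (le_neg_of_le_neg (hgen j hj)) (hF n j)
  have hn : ∀ n, μ 1 * occupation μ ν x n t 1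
      + ε * ∑ j ∈ range (J + 2), occupation μ ν x n t j
      ≤ ∑' j, -generator μ ν w j * occupation μ ν x n t j := fun n => by
    have hs : Summable fun j => -generator μ ν w j * occupation μ ν x n t j := by
      simpa only [neg_mul] using
        (summable_generator_mul_occupation hμ hν hx hwn hwb hx1.summable n ht).neg
    refine le_trans (le_of_eq ?_) ((sum_le_sum fun j _ => hpt n j).trans
      (hs.sum_le_tsum (range (J + 2)) fun j _ => ?_))
    -- The range `J + 2` always contains the state `1`, so the killing term appears exactly once.
    · simp [add_mul, sum_add_distrib, mul_sum, add_comm]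
    · refine (mul_nonneg (add_nonneg hε ?_) (hF n j)).trans (hpt n j)
      split_ifs
      exacts [hμ 1, le_rfl]
  simp only [integral_partialLaw]
  calc _ = ∑ n ∈ range N, (μ 1 * occupation μ ν x n t 1
          + ε * ∑ j ∈ range (J + 2), occupation μ ν x n t j) := by
        rw [sum_add_distrib, ← mul_sum, ← mul_sum, sum_comm]
    _ ≤ ∑ n ∈ range N, ∑' j, -generator μ ν w j * occupation μ ν x n t j :=
        sum_le_sum fun n _ => hn n
    _ ≤ ∑' j, w j * x j :=
        sum_tsum_neg_generator_mul_occupation_le hμ hν hx hwn hwb hw0 hx1.summable N ht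
    _ ≤ ∑' j, b * x j := (summable_weight_mul hwn hwb hx1.summable hx).tsum_le_tsum
        (fun j => mul_le_mul_of_nonneg_right (hwb j) (hx j)) (hx1.summable.mul_left b)
    _ = b := by rw [tsum_mul_left, hx1.tsum_eq, mul_one]

/-- Explosion criterion: such a Lyapunov function with `b < 1` forces explosion. -/
theorem exists_explosionProb_pos (hμ : ∀ j, 0 ≤ μ j) (hν : ∀ j, 0 ≤ ν j) (hx : ∀ j, 0 ≤ x j)
    (hx1 : HasSum x 1) (hw0 : w 0 = 0) (hwn : ∀ j, 0 ≤ w j) (hwb : ∀ j, w j ≤ b) (hb : b < 1)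
    (hε : 0 < ε) (hgen : ∀ j, 1 ≤ j → generator μ ν w j ≤ -(ε + if j = 1 then μ 1 else 0)) :
    ∃ t, 0 < t ∧ 0 < explosionProb μ ν x t := by
  by_contra! hcon
  have hxs := hx1.summable
  have hb0 : 0 ≤ b := (hwn 0).trans (hwb 0)
  have hI0 : ∀ t, 0 ≤ t → ∀ j, 0 ≤ ∫ s in (0 : ℝ)..t, minimalLaw μ ν x s j := fun t ht j =>
    intervalIntegral.integral_nonneg ht fun s hs => minimalLaw_nonneg hμ hν hx hs.1 j
  have hbound := fun J t ht => killing_add_lifetime_le hμ hν hx hx1 hw0 hwn hwb hε.le hgen J (t := t) ht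
  -- Without explosion all missing mass has been killed, and the killed mass is at most `b`.
  have hmass : ∀ s, 0 < s → 1 - b ≤ ∑' j, minimalLaw μ ν x s j := fun s hs => by
    have h1 := hcon s hs
    have h2 := hbound 0 s hs.le
    have h3 := mul_nonneg hε.le (sum_nonneg fun j (_ : j ∈ range (0 + 2)) => hI0 s hs.le j)
    unfold explosionProb at h1
    linarith
  have hlin : ∀ t, 0 ≤ t → ε * ((1 - b) * t) ≤ b := fun t ht => by
    have hcont : ∀ J, ContinuousOn (fun s => ∑ j ∈ range J, minimalLaw μ ν x s j) (Set.Ici 0) :=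
      fun J => continuousOn_finsetSum _ fun j _ => continuousOn_minimalLaw hμ hν hx hxs j
    -- Capping the finite sums at `1 - b` makes them dominated, with a constant limit by `hmass`;
    -- the infinite sum itself is never integrated.
    have hmin : ∀ J, ContinuousOn
        (fun s => min (∑ j ∈ range J, minimalLaw μ ν x s j) (1 - b)) (Set.Ici 0) :=
      fun J => (hcont J).inf continuousOn_const
    have hlim : Tendsto (fun J => ∫ s in (0 : ℝ)..t,
        min (∑ j ∈ range J, minimalLaw μ ν x s j) (1 - b)) atTop
        (𝓝 (∫ _ in (0 : ℝ)..t, (1 - b))) := by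
      refine intervalIntegral.tendsto_integral_filter_of_dominated_convergence
        (fun _ => 1 - b) ?_ ?_ intervalIntegrable_const ?_
      · exact Eventually.of_forall fun J =>
          (intervalIntegrable_of_continuousOn_Ici (hmin J) ht).def'.aestronglyMeasurable
      · refine Eventually.of_forall fun J => Eventually.of_forall fun s hs => ?_
        rw [Set.uIoc_of_le ht] at hs
        rw [Real.norm_of_nonneg (le_min (sum_nonneg fun j _ =>
          minimalLaw_nonneg hμ hν hx hs.1.le j) (by linarith))]
        exact min_le_right _ _
      · refine Eventually.of_forall fun s hs => ?_
        rw [Set.uIoc_of_le ht] at hs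
        have h := ((summable_minimalLaw hμ hν hx hxs hs.1.le).hasSum.tendsto_sum_nat).min
          (tendsto_const_nhds (x := 1 - b))
        rwa [min_eq_right (hmass s hs.1)] at h
    rw [intervalIntegral.integral_const, sub_zero, smul_eq_mul, mul_comm t] at hlim
    refine le_of_tendsto' (((tendsto_add_atTop_iff_nat 2).2 hlim).const_mul ε) fun J => ?_
    have h1 := hbound J t ht
    have h2 := mul_nonneg (hμ 1) (hI0 t ht 1)
    refine le_trans (mul_le_mul_of_nonneg_left ?_ hε.le) ((le_add_of_nonneg_left h2).trans h1)
    rw [← intervalIntegral.integral_finsetSum fun j _ =>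
      intervalIntegrable_of_continuousOn_Ici (continuousOn_minimalLaw hμ hν hx hxs j) ht]
    exact intervalIntegral.integral_mono_on ht
      (intervalIntegrable_of_continuousOn_Ici (hmin _) ht)
      (intervalIntegrable_of_continuousOn_Ici (hcont _) ht) fun s _ => min_le_left _ _
  have hc : 0 < ε * (1 - b) := mul_pos hε (by linarith)
  -- At this time the linear lower bound equals `b + 1`, beyond the permitted `b`.
  have h := hlin ((b + 1) / (ε * (1 - b))) (by positivity)
  rw [← mul_assoc, mul_div_cancel₀ _ hc.ne'] at h
  linarith

end Explosion

/-! ### The Lyapunov function for geometric rates -/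

section GeometricRates

/-- A Lyapunov function for explosion when the symmetric rates grow geometrically. -/
theorem exists_lyapunov_of_geometric {μ ν : ℕ → ℝ} {a r : ℝ} (ha : 0 < a) (hr : 1 < r)
    (hμ1 : 0 ≤ μ 1) (hν : ∀ j, 1 ≤ j → ν j = a * r ^ j)
    (hsymm : ∀ j, 1 ≤ j → μ (j + 1) = ν j) :
    ∃ (w : ℕ → ℝ) (b ε : ℝ), w 0 = 0 ∧ (∀ j, 0 ≤ w j) ∧ (∀ j, w j ≤ b) ∧ b < 1 ∧ 0 < ε ∧
      ∀ j, 1 ≤ j → generator μ ν w j ≤ -(ε + if j = 1 then μ 1 else 0) := by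
  -- Any ratio in `(1/r, 1)` works: `ρ < 1` makes `w` decrease along the states `j ≥ 1`, and `r * ρ
  -- > 1` keeps its generator away from `0` as `j` grows.
  set ρ : ℝ := (1 + 1 / r) / 2 with hρ
  have hr0 : 0 < r := by linarith
  have hrρ : r * ρ = (r + 1) / 2 := by rw [hρ]; field_simp
  have hρ0 : 0 < ρ := by positivity
  have hρ1 : ρ < 1 := by nlinarith
  set G : ℝ := a * r * (1 - ρ) with hG
  have hG0 : 0 < G := mul_pos (mul_pos ha hr0) (by linarith)
  -- At `1` the generator is `-(1 - δ) * (G + μ 1)`. This `δ` makes it `-(G / 2 + μ 1)`, leaving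
  -- room for the killing rate while the bound `1 - δ` stays below `1`.
  set δ : ℝ := G / (2 * (G + μ 1)) with hδ
  have hδe : δ * (G + μ 1) = G / 2 := by rw [hδ]; field_simp
  have hδ0 : 0 < δ := by positivity
  have hδ1 : δ ≤ 1 / 2 := by nlinarith
  refine ⟨fun j => if j = 0 then 0 else (1 - δ) * ρ ^ (j - 1), 1 - δ,
    min (G / 2) (G * (r * ρ - 1) / 2), by simp, fun j => ?_, fun j => ?_, by linarith,
    lt_min (by linarith) ?_, fun j hj => ?_⟩
  · dsimp only
    split_ifs
    exacts [le_rfl, mul_nonneg (by linarith) (pow_nonneg hρ0.le _)]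
  · dsimp only
    split_ifs
    exacts [by linarith, mul_le_of_le_one_right (by linarith) (pow_le_one₀ hρ0.le hρ1.le)]
  · exact half_pos (mul_pos hG0 (by linarith))
  · obtain ⟨k, rfl⟩ := Nat.exists_eq_add_of_le' hj
    rcases k with _ | k
    · have h := min_le_left (G / 2) (G * (r * ρ - 1) / 2)
      have h1 := hν 1 le_rfl
      simp only [generator, zero_add, Nat.sub_self, if_true, one_ne_zero, if_false, pow_zero,
        Nat.reduceAdd, Nat.reduceSub, pow_one, OfNat.ofNat_ne_zero] at h1 ⊢
      rw [h1]
      nlinarith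
    · have h := min_le_right (G / 2) (G * (r * ρ - 1) / 2)
      have h1 := hν (k + 1) (by omega)
      have h2 := hν (k + 2) (by omega)
      have h3 := hsymm (k + 1) (by omega)
      simp only [generator, show k + 1 + 1 = k + 2 by omega, show k + 2 + 1 = k + 3 by omega,
        show k + 2 - 1 = k + 1 by omega, show k + 3 - 1 = k + 2 by omega,
        show k + 1 - 1 = k by omega, show k + 2 ≠ 1 by omega, show k + 2 ≠ 0 by omega,
        show k + 3 ≠ 0 by omega, show k + 1 ≠ 0 by omega, if_false, add_zero] at h3 ⊢
      rw [h3, h2, h1]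
      have hp : 1 ≤ (r * ρ) ^ k := one_le_pow₀ (by linarith)
      have hid : a * r ^ (k + 2) * ((1 - δ) * ρ ^ (k + 2)) + a * r ^ (k + 1) * ((1 - δ) * ρ ^ k)
          - (a * r ^ (k + 2) + a * r ^ (k + 1)) * ((1 - δ) * ρ ^ (k + 1))
          = -((1 - δ) * (r * ρ) ^ k * (G * (r * ρ - 1))) := by
        rw [mul_pow, hG]; ring
      rw [hid]
      have h4 : 0 ≤ G * (r * ρ - 1) := mul_nonneg hG0.le (by linarith)
      have h5 : 1 / 2 ≤ (1 - δ) * (r * ρ) ^ k := by nlinarith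
      linarith [mul_le_mul_of_nonneg_right h5 h4]

end GeometricRates

/-! ### Rates and initial law of the shell model -/

section ShellModel

variable {lam lam0 σ θ : ℝ}

theorem birthRate_eq_geometric (hlam : 0 ≤ lam) {j : ℕ} (hj : 1 ≤ j) :
    birthRate lam lam0 σ θ j = σ ^ 2 * (lam ^ (2 * θ)) ^ j := by
  rw [birthRate, shellFreq, if_neg (by omega), Real.rpow_pow_comm hlam]

theorem deathRate_succ (lam lam0 σ θ : ℝ) (j : ℕ) :
    deathRate lam lam0 σ θ (j + 1) = birthRate lam lam0 σ θ j := rfl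

theorem shellFreq_nonneg (hlam : 0 ≤ lam) (hlam0 : 0 ≤ lam0) (j : ℕ) :
    0 ≤ shellFreq lam lam0 j := by
  unfold shellFreq
  split_ifs
  exacts [hlam0, pow_nonneg hlam j]

theorem birthRate_nonneg (hlam : 0 ≤ lam) (hlam0 : 0 ≤ lam0) (j : ℕ) :
    0 ≤ birthRate lam lam0 σ θ j :=
  mul_nonneg (sq_nonneg σ) (Real.rpow_nonneg (shellFreq_nonneg hlam hlam0 j) _)

theorem deathRate_nonneg (hlam : 0 ≤ lam) (hlam0 : 0 ≤ lam0) (j : ℕ) :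
    0 ≤ deathRate lam lam0 σ θ j :=
  mul_nonneg (sq_nonneg σ) (Real.rpow_nonneg (shellFreq_nonneg hlam hlam0 _) _)

theorem initialEnergy_nonneg (p m : lp (fun _ : ℕ+ => ℝ) 2) (j : ℕ) : 0 ≤ initialEnergy p m j := by
  unfold initialEnergy
  split_ifs
  exacts [by positivity, le_rfl]

theorem hasSum_initialEnergy {p m : lp (fun _ : ℕ+ => ℝ) 2} (hpm : p ≠ 0 ∨ m ≠ 0) :
    HasSum (initialEnergy p m) 1 := by
  have hnorm : ∀ f : lp (fun _ : ℕ+ => ℝ) 2, HasSum (fun i => f i ^ 2) (‖f‖ ^ 2) := fun f => by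
    simpa using lp.hasSum_norm (p := 2) (by norm_num) f
  have hpos : 0 < ‖p‖ ^ 2 + ‖m‖ ^ 2 := by
    rcases hpm with h | h
    · have := norm_pos_iff.2 h
      positivity
    · have := norm_pos_iff.2 h
      positivity
  have h := ((hnorm p).add (hnorm m)).div_const (‖p‖ ^ 2 + ‖m‖ ^ 2)
  rw [div_self hpos.ne'] at h
  refine (PNat.coe_injective.hasSum_iff fun j hj => ?_).1 (h.congr_fun fun i => ?_)
  · refine dif_neg fun hj0 => hj ⟨⟨j, hj0⟩, rfl⟩
  · exact dif_pos i.pos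

end ShellModel

theorem corollary4p3 (lam lam0 σ θ : ℝ) (hlam : 1 < lam) (hlam0 : 0 ≤ lam0) (hσ : σ ≠ 0)
    (hθ : 0 < θ) (p m : lp (fun _ : ℕ+ => ℝ) 2) (hpm : p ≠ 0 ∨ m ≠ 0) :
    let μ := deathRate lam lam0 σ θ
    let ν := birthRate lam lam0 σ θ
    let x := initialEnergy p m
    -- the law of the minimal process is a solution of the forward equation, of mass at most one
    (IsForwardSolution μ ν x (minimalLaw μ ν x) ∧
      ∀ t, 0 ≤ t → ∑' j, minimalLaw μ ν x t j ≤ 1) ∧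
    -- it is the only solution
    (∀ e : ℝ → ℕ → ℝ, IsForwardSolution μ ν x e →
      ∀ t, 0 ≤ t → ∀ j, e t j = minimalLaw μ ν x t j) ∧
    -- the minimal process is dishonest
    (∃ t, 0 < t ∧ 0 < explosionProb μ ν x t) := by
  intro μ ν x
  have hlam' : 0 ≤ lam := by linarith
  have hμ : ∀ j, 0 ≤ μ j := deathRate_nonneg hlam' hlam0
  have hν : ∀ j, 0 ≤ ν j := birthRate_nonneg hlam' hlam0
  have hx : ∀ j, 0 ≤ x j := initialEnergy_nonneg p m
  have hx1 : HasSum x 1 := hasSum_initialEnergy hpm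
  have hσ2 : 0 < σ ^ 2 := by positivity
  have hr : 1 < lam ^ (2 * θ) := Real.one_lt_rpow hlam (by linarith)
  have hgeo : ∀ j, 1 ≤ j → ν j = σ ^ 2 * (lam ^ (2 * θ)) ^ j := fun j hj =>
    birthRate_eq_geometric hlam' hj
  have hpos : ∀ j, 1 ≤ j → 0 < ν j := fun j hj => by
    rw [hgeo j hj]
    positivity
  have hsymm : ∀ j, 1 ≤ j → μ (j + 1) = ν j := fun j _ => deathRate_succ lam lam0 σ θ j
  refine ⟨⟨isForwardSolution_minimalLaw hμ hν hx hx1.summable, fun t ht => ?_⟩,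
    fun e he t ht j => he.eq_minimalLaw hμ hν hx hx1.summable hpos hsymm ht j, ?_⟩
  · exact (tsum_minimalLaw_le hμ hν hx hx1.summable ht).trans_eq hx1.tsum_eq
  · obtain ⟨w, b, ε, hw0, hwn, hwb, hb, hε, hgen⟩ :=
      exists_lyapunov_of_geometric hσ2 hr (hμ 1) hgeo hsymm
    exact exists_explosionProb_pos hμ hν hx hx1 hw0 hwn hwb hb hε hgen
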